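/- Let $e,\gamma,\xi>0$ and let $\alpha_1,\alpha_2,\beta_1,\beta_2\in\mathbb{R}$. Consider positive $C^2$ functions $q_1,q_2$ on $\mathbb{R}$ solving the domain wall equations of the $U(2)$ non-Abelian Yang–Mills–Higgs theory, $$(\ln q_1)''=\frac{e^2}{4}\left((1+\gamma)q_1^2+(1-\gamma)q_2^2-2\xi\right),\qquad (\ln q_2)''=\frac{e^2}{4}\left((1-\gamma)q_1^2+(1+\gamma)q_2^2-2\xi\right),$$ with the boundary condition $q_1(\pm\infty)=q_2(\pm\infty)=0$. Say that $(q_1,q_2)$ has the sharp decay if, for $i=1,2$, $$q_i^2(x)\asymp \mathrm{e}^{\alpha_i x-\frac12 e^2\xi x^2}\ \text{ as } x\to\infty,\qquad q_i^2(x)\asymp \mathrm{e}^{-\beta_i x-\frac12 e^2\xi x^2}\ \text{ as } x\to-\infty,$$ where $f\asymp g$ means $f=\mathrm{O}(g)$ and $g=\mathrm{O}(f)$. Consider the condition $$(1+\gamma)(\alpha_1+\beta_1)+(\gamma-1)(\alpha_2+\beta_2)>0,\qquad (\gamma-1)(\alpha_1+\beta_1)+(1+\gamma)(\alpha_2+\beta_2)>0.\tag{P}$$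 1. If (P) holds, there is exactly one such solution $(q_1,q_2)$ with the sharp decay. 2. Every such solution with the sharp decay has $q_1^2,q_2^2$ integrable over $\mathbb{R}$, with $$\int_{\mathbb{R}}q_1^2\,\mathrm{d}x=\frac{1}{2e^2\gamma}\left((1+\gamma)(\alpha_1+\beta_1)+(\gamma-1)(\alpha_2+\beta_2)\right),\qquad \int_{\mathbb{R}}q_2^2\,\mathrm{d}x=\frac{1}{2e^2\gamma}\left((\gamma-1)(\alpha_1+\beta_1)+(1+\gamma)(\alpha_2+\beta_2)\right).$$ 3. If (P) holds, there is also exactly one such solution $(q_1,q_2)$ for which $q_1^2,q_2^2$ are integrable with the integrals in 2 and for which only the upper bounds $q_i^2=\mathrm{O}(\mathrm{e}^{\alpha_i x-\frac12 e^2\xi x^2})$ as $x\to\infty$ and $q_i^2=\mathrm{O}(\mathrm{e}^{-\beta_i x-\frac12 e^2\xi x^2})$ as $x\to-\infty$ $(i=1,2)$ are required. 4. Condition (P) is necessary: if a solution with the sharp decay exists, then (P) holds. -/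

import Mathlib

open Filter Topology Asymptotics MeasureTheory

/-- A positive classical solution `(q₁, q₂)` on the whole real line of the domain wall equations
`(ln q₁)'' = (e² / 4) ((1 + γ) q₁² + (1 - γ) q₂² - 2 ξ)`,
`(ln q₂)'' = (e² / 4) ((1 - γ) q₁² + (1 + γ) q₂² - 2 ξ)`
with the boundary condition `q₁(±∞) = q₂(±∞) = 0`. -/
structure IsDomainWall (e γ ξ : ℝ) (q₁ q₂ : ℝ → ℝ) : Prop where
  contDiff₁ : ContDiff ℝ 2 q₁
  contDiff₂ : ContDiff ℝ 2 q₂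
  pos₁ : ∀ x, 0 < q₁ x
  pos₂ : ∀ x, 0 < q₂ x
  eqn₁ : ∀ x, deriv (deriv fun y => Real.log (q₁ y)) x
    = e ^ 2 / 4 * ((1 + γ) * q₁ x ^ 2 + (1 - γ) * q₂ x ^ 2 - 2 * ξ)
  eqn₂ : ∀ x, deriv (deriv fun y => Real.log (q₂ y)) x
    = e ^ 2 / 4 * ((1 - γ) * q₁ x ^ 2 + (1 + γ) * q₂ x ^ 2 - 2 * ξ)
  tendsto_atTop₁ : Tendsto q₁ atTop (𝓝 0)
  tendsto_atTop₂ : Tendsto q₂ atTop (𝓝 0)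
  tendsto_atBot₁ : Tendsto q₁ atBot (𝓝 0)
  tendsto_atBot₂ : Tendsto q₂ atBot (𝓝 0)

/-- The one-sided estimates `q² = O(exp (α x - e² ξ x² / 2))` as `x → ∞` and
`q² = O(exp (-β x - e² ξ x² / 2))` as `x → -∞`. -/
def HasDecay (e ξ α β : ℝ) (q : ℝ → ℝ) : Prop :=
  ((fun x => q x ^ 2) =O[atTop] fun x => Real.exp (α * x - e ^ 2 * ξ * x ^ 2 / 2)) ∧
  ((fun x => q x ^ 2) =O[atBot] fun x => Real.exp (-β * x - e ^ 2 * ξ * x ^ 2 / 2))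

/-- The same estimates in the sharp sense: near `+∞` and near `-∞`, the function `q²` lies between
two positive constant multiples of the corresponding exponential. -/
def HasSharpDecay (e ξ α β : ℝ) (q : ℝ → ℝ) : Prop :=
  ((fun x => q x ^ 2) =Θ[atTop] fun x => Real.exp (α * x - e ^ 2 * ξ * x ^ 2 / 2)) ∧
  ((fun x => q x ^ 2) =Θ[atBot] fun x => Real.exp (-β * x - e ^ 2 * ξ * x ^ 2 / 2))

/-- The positivity conditions on the parameters. -/
def PositivityCondition (γ α₁ α₂ β₁ β₂ : ℝ) : Prop :=
  0 < (1 + γ) * (α₁ + β₁) + (γ - 1) * (α₂ + β₂) ∧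
  0 < (γ - 1) * (α₁ + β₁) + (1 + γ) * (α₂ + β₂)

/-- `q₁²` and `q₂²` are integrable over the real line, with the prescribed integrals. -/
def HasExactIntegrals (e γ α₁ α₂ β₁ β₂ : ℝ) (q₁ q₂ : ℝ → ℝ) : Prop :=
  Integrable (fun x => q₁ x ^ 2) ∧ Integrable (fun x => q₂ x ^ 2) ∧
  ∫ x, q₁ x ^ 2 = 1 / (2 * e ^ 2 * γ) * ((1 + γ) * (α₁ + β₁) + (γ - 1) * (α₂ + β₂)) ∧
  ∫ x, q₂ x ^ 2 = 1 / (2 * e ^ 2 * γ) * ((γ - 1) * (α₁ + β₁) + (1 + γ) * (α₂ + β₂))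

/-! With `u i = 2 ln q i` the equations read `u₁'' = κ ((1 + γ) exp u₁ + (1 - γ) exp u₂) - e² ξ` and
symmetrically for `u₂`, where `κ = e² / 2`. Sharp decay says that `u i` stays at bounded distance
from an explicit profile (`hasSharpDecay_iff`).

Integrals and necessity: a function whose second derivative has a finite first moment is affine at
each end up to a bounded error, and the slope jumps by the total mass of that derivative
(`exists_asymptotes`). Matching slopes with the profile gives two linear equations for `∫ q₁²` and
`∫ q₂²`, whose solution is the stated pair; positivity of the integrals is then (P). Conversely,
upper bounds together with these integrals force sharp decay, which reduces the third claim to the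
first.

Uniqueness: for two solutions with logarithmic differences `d₁`, `d₂`, the quadratic form `γ (d₁ +
d₂)² + (d₁ - d₂)²` is convex and bounded, so its second derivative vanishes, which forces `d₁ = d₂ =
0` (`IsDomainWall.eq_of_hasSharpDecay`).

Existence: prescribing the masses `M i`, positive by (P), turns the problem into a mean field
integral equation. Since `γ > 0`, the coupling matrix tensored with the kernel `(|x| + |y| - |x -
y|) / 2` is a Gram kernel in `L² × L²`. The equation is therefore stationarity of `‖z‖² / 2 + ∑ κ M
i log ∫ exp (U i + ⟪k i x, z⟫)`, with `U i` the profiles. This functional is strongly convex and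
bounded below, so it has a minimiser (`exists_stationary_log_partition`, `exists_mean_field`). -/

/-- A continuous, bounded below, strongly midpoint convex function attains its minimum. -/
theorem exists_forall_le_of_strongly_midpoint_convex {H : Type*} [NormedAddCommGroup H]
    [NormedSpace ℝ H] [CompleteSpace H] {J : H → ℝ} (hc : Continuous J)
    (hb : BddBelow (Set.range J))
    (hJ : ∀ z w, J ((1 / 2 : ℝ) • (z + w)) ≤ (J z + J w) / 2 - ‖z - w‖ ^ 2 / 8) :
    ∃ z, ∀ w, J z ≤ J w := by
  have hle : ∀ w, iInf J ≤ J w := fun w => ciInf_le hb w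
  have hex : ∀ n : ℕ, ∃ z, J z < iInf J + 1 / ((n : ℝ) + 1) := fun n =>
    exists_lt_of_ciInf_lt (lt_add_of_pos_right _ (by positivity))
  choose z hz using hex
  have hcau : CauchySeq z := by
    -- The midpoint of two almost minimisers has value at least the infimum, so strong convexity
    -- gives `‖z n - z m‖² ≤ 8 / (N + 1)`.
    refine cauchySeq_of_le_tendsto_0 (fun N : ℕ => Real.sqrt (8 * (1 / ((N : ℝ) + 1)))) ?_ ?_
    · intro n m N hn hm
      rw [dist_eq_norm]
      apply Real.le_sqrt_of_sq_le
      have h1 : 1 / ((n : ℝ) + 1) ≤ 1 / ((N : ℝ) + 1) := by gcongr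
      have h2 : 1 / ((m : ℝ) + 1) ≤ 1 / ((N : ℝ) + 1) := by gcongr
      have := hJ (z n) (z m)
      have := hle ((1 / 2 : ℝ) • (z n + z m))
      linarith [hz n, hz m]
    · have h := (tendsto_one_div_add_atTop_nhds_zero_nat (𝕜 := ℝ)).const_mul 8
      simpa only [Function.comp_def, mul_zero, Real.sqrt_zero] using
        (Real.continuous_sqrt.tendsto _).comp h
  obtain ⟨p, hp⟩ := cauchySeq_tendsto_of_complete hcau
  refine ⟨p, fun w => le_trans ?_ (hle w)⟩
  have h1 : Tendsto (fun n => J (z n)) atTop (𝓝 (J p)) := (hc.tendsto p).comp hp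
  have h2 : Tendsto (fun n : ℕ => iInf J + 1 / ((n : ℝ) + 1)) atTop (𝓝 (iInf J + 0)) :=
    tendsto_const_nhds.add (tendsto_one_div_add_atTop_nhds_zero_nat (𝕜 := ℝ))
  rw [add_zero] at h2
  exact le_of_tendsto_of_tendsto' h1 h2 fun n => (hz n).le

/-! ### Log-partition functions on a Hilbert space -/

section LogPartition

variable {X H : Type*} [MeasurableSpace X] [NormedAddCommGroup H] [InnerProductSpace ℝ H]
  {ν : Measure X} {k : X → H}

theorem integrable_exp_inner (hk : AEStronglyMeasurable k ν)
    (hexp : ∀ R : ℝ, Integrable (fun x => Real.exp (R * ‖k x‖)) ν) (z : H) :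
    Integrable (fun x => Real.exp (inner ℝ (k x) z)) ν := by
  refine (hexp ‖z‖).mono'
    (Real.continuous_exp.comp_aestronglyMeasurable (hk.inner aestronglyMeasurable_const)) ?_
  refine Eventually.of_forall fun x => ?_
  rw [Real.norm_of_nonneg (Real.exp_pos _).le, Real.exp_le_exp]
  linarith [real_inner_le_norm (k x) z]

theorem integral_exp_inner_pos [NeZero ν] (hk : AEStronglyMeasurable k ν)
    (hexp : ∀ R : ℝ, Integrable (fun x => Real.exp (R * ‖k x‖)) ν) (z : H) :
    0 < ∫ x, Real.exp (inner ℝ (k x) z) ∂ν :=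
  integral_exp_pos (integrable_exp_inner hk hexp z)

theorem continuous_integral_exp_inner (hk : AEStronglyMeasurable k ν)
    (hexp : ∀ R : ℝ, Integrable (fun x => Real.exp (R * ‖k x‖)) ν) :
    Continuous fun z => ∫ x, Real.exp (inner ℝ (k x) z) ∂ν := by
  refine continuous_iff_continuousAt.2 fun z => ?_
  refine continuousAt_of_dominated (bound := fun x => Real.exp ((‖z‖ + 1) * ‖k x‖)) ?_ ?_
    (hexp _) ?_
  · exact Eventually.of_forall fun w => (integrable_exp_inner hk hexp w).1
  · filter_upwards [Metric.ball_mem_nhds z one_pos] with w hw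
    refine Eventually.of_forall fun x => ?_
    rw [Real.norm_of_nonneg (Real.exp_pos _).le, Real.exp_le_exp]
    have h1 : ‖w‖ ≤ ‖z‖ + 1 := by
      have := norm_sub_norm_le w z
      rw [mem_ball_iff_norm] at hw
      linarith
    calc inner ℝ (k x) w ≤ ‖k x‖ * ‖w‖ := real_inner_le_norm _ _
      _ ≤ ‖k x‖ * (‖z‖ + 1) := by gcongr
      _ = _ := mul_comm _ _
  · exact Eventually.of_forall fun x => by fun_prop

theorem hasDerivAt_integral_exp_inner (hk : AEStronglyMeasurable k ν)
    (hexp : ∀ R : ℝ, Integrable (fun x => Real.exp (R * ‖k x‖)) ν) (z h : H) :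
    HasDerivAt (fun t : ℝ => ∫ x, Real.exp (inner ℝ (k x) (z + t • h)) ∂ν)
      (∫ x, Real.exp (inner ℝ (k x) z) * inner ℝ (k x) h ∂ν) 0 := by
  have hmeas : ∀ w : H, AEStronglyMeasurable (fun x => inner ℝ (k x) w) ν := fun w =>
    hk.inner aestronglyMeasurable_const
  have key := (hasDerivAt_integral_of_dominated_loc_of_deriv_le (μ := ν) (x₀ := (0 : ℝ))
    (s := Metric.ball 0 1)
    (F := fun t x => Real.exp (inner ℝ (k x) (z + t • h)))
    (F' := fun t x => Real.exp (inner ℝ (k x) (z + t • h)) * inner ℝ (k x) h)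
    -- One `‖h‖` comes from `|t| < 1`, the other from absorbing the factor `⟪k x, h⟫` into an
    -- exponential.
    (bound := fun x => Real.exp ((‖z‖ + 2 * ‖h‖) * ‖k x‖))
    (Metric.ball_mem_nhds _ one_pos)
    (Eventually.of_forall fun t => (integrable_exp_inner hk hexp _).1)
    (integrable_exp_inner hk hexp _)
    ((Real.continuous_exp.comp_aestronglyMeasurable (hmeas _)).mul (hmeas _))
    ?_ (hexp _) ?_).2
  · simpa using key
  · refine Eventually.of_forall fun x t ht => ?_
    rw [mem_ball_zero_iff, Real.norm_eq_abs] at ht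
    rw [norm_mul, Real.norm_of_nonneg (Real.exp_pos _).le]
    have h1 : inner ℝ (k x) (z + t • h) ≤ (‖z‖ + ‖h‖) * ‖k x‖ := by
      have h2 : ‖z + t • h‖ ≤ ‖z‖ + ‖h‖ := by
        refine (norm_add_le _ _).trans ?_
        rw [norm_smul, Real.norm_eq_abs]
        nlinarith [norm_nonneg h]
      calc inner ℝ (k x) (z + t • h) ≤ ‖k x‖ * ‖z + t • h‖ := real_inner_le_norm _ _
        _ ≤ ‖k x‖ * (‖z‖ + ‖h‖) := by gcongr
        _ = _ := mul_comm _ _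
    have h3 : ‖(inner ℝ (k x) h : ℝ)‖ ≤ Real.exp (‖h‖ * ‖k x‖) := by
      refine (norm_inner_le_norm _ _).trans ?_
      linarith [Real.add_one_le_exp (‖h‖ * ‖k x‖), mul_comm ‖k x‖ ‖h‖]
    calc _ ≤ Real.exp ((‖z‖ + ‖h‖) * ‖k x‖) * Real.exp (‖h‖ * ‖k x‖) := by gcongr
      _ = _ := by rw [← Real.exp_add]; congr 1; ring
  · refine Eventually.of_forall fun x t _ => ?_
    have h1 : HasDerivAt (fun t : ℝ => inner ℝ (k x) (z + t • h)) (inner ℝ (k x) h) t := by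
      simp only [inner_add_right, inner_smul_right]
      simpa using ((hasDerivAt_id t).mul_const (inner ℝ (k x) h)).const_add (inner ℝ (k x) z)
    exact h1.exp

/-- AM-GM after normalisation: once the two exponentials are divided by their integrals `exp a` and
`exp b`, their geometric mean is at most their arithmetic mean, which integrates to 1. -/
theorem log_integral_exp_inner_midpoint_le [NeZero ν] (hk : AEStronglyMeasurable k ν)
    (hexp : ∀ R : ℝ, Integrable (fun x => Real.exp (R * ‖k x‖)) ν) (z w : H) :
    Real.log (∫ x, Real.exp (inner ℝ (k x) ((1 / 2 : ℝ) • (z + w))) ∂ν) ≤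
      (Real.log (∫ x, Real.exp (inner ℝ (k x) z) ∂ν) +
        Real.log (∫ x, Real.exp (inner ℝ (k x) w) ∂ν)) / 2 := by
  set a := Real.log (∫ x, Real.exp (inner ℝ (k x) z) ∂ν) with ha
  set b := Real.log (∫ x, Real.exp (inner ℝ (k x) w) ∂ν) with hb
  have hz := integrable_exp_inner hk hexp z
  have hw := integrable_exp_inner hk hexp w
  have hea : Real.exp a = ∫ x, Real.exp (inner ℝ (k x) z) ∂ν :=
    Real.exp_log (integral_exp_inner_pos hk hexp z)
  have heb : Real.exp b = ∫ x, Real.exp (inner ℝ (k x) w) ∂ν :=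
    Real.exp_log (integral_exp_inner_pos hk hexp w)
  have hpt : ∀ x, Real.exp (inner ℝ (k x) ((1 / 2 : ℝ) • (z + w))) ≤
      Real.exp ((a + b) / 2) * (Real.exp (-a) * Real.exp (inner ℝ (k x) z) / 2 +
        Real.exp (-b) * Real.exp (inner ℝ (k x) w) / 2) := by
    intro x
    rw [inner_smul_right, inner_add_right, ← Real.exp_add, ← Real.exp_add]
    set s := inner ℝ (k x) z
    set t := inner ℝ (k x) w
    have h1 : (1 / 2 : ℝ) * (s + t) = (a + b) / 2 + ((-a + s) / 2 + (-b + t) / 2) := by ring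
    rw [h1, Real.exp_add, Real.exp_add]
    gcongr
    have h2 := Real.exp_add ((-a + s) / 2) ((-a + s) / 2)
    have h3 := Real.exp_add ((-b + t) / 2) ((-b + t) / 2)
    rw [add_halves] at h2 h3
    nlinarith [sq_nonneg (Real.exp ((-a + s) / 2) - Real.exp ((-b + t) / 2))]
  have hint := integral_mono (integrable_exp_inner hk hexp _)
    (((hz.const_mul (Real.exp (-a))).div_const 2).add
      ((hw.const_mul (Real.exp (-b))).div_const 2) |>.const_mul (Real.exp ((a + b) / 2))) hpt
  have hval : ∫ x, Real.exp ((a + b) / 2) * (Real.exp (-a) * Real.exp (inner ℝ (k x) z) / 2 +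
        Real.exp (-b) * Real.exp (inner ℝ (k x) w) / 2) ∂ν = Real.exp ((a + b) / 2) := by
    rw [integral_const_mul, integral_add ((hz.const_mul _).div_const 2)
      ((hw.const_mul _).div_const 2), integral_div, integral_div, integral_const_mul,
      integral_const_mul, ← hea, ← heb, ← Real.exp_add, ← Real.exp_add]
    norm_num
  rw [Real.log_le_iff_le_exp (integral_exp_inner_pos hk hexp _)]
  exact hint.trans hval.le

/-- Jensen's inequality in tangent-line form, at the mean `m` of `‖k‖`. A lower bound linear in
`‖z‖` suffices, because the functional also contains `‖z‖² / 2`. -/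
theorem exists_log_integral_exp_inner_ge [NeZero ν] (hk : AEStronglyMeasurable k ν)
    (hexp : ∀ R : ℝ, Integrable (fun x => Real.exp (R * ‖k x‖)) ν) :
    ∃ B C : ℝ, ∀ z, B - C * ‖z‖ ≤ Real.log (∫ x, Real.exp (inner ℝ (k x) z) ∂ν) := by
  have hfin : IsFiniteMeasure ν := by
    have := hexp 0
    simp only [zero_mul, Real.exp_zero] at this
    exact (integrable_const_iff_isFiniteMeasure one_ne_zero).1 this
  have hνpos : 0 < ν.real Set.univ := by
    have := integral_exp_inner_pos hk hexp (0 : H)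
    simp only [inner_zero_right, Real.exp_zero, integral_const, smul_eq_mul, mul_one] at this
    exact this
  have hkn : Integrable (fun x => ‖k x‖) ν := by
    refine (hexp 1).mono' hk.norm (Eventually.of_forall fun x => ?_)
    rw [norm_norm, one_mul]
    linarith [Real.add_one_le_exp ‖k x‖]
  set m := (∫ x, ‖k x‖ ∂ν) / ν.real Set.univ with hm
  have hmm : ∫ x, ‖k x‖ ∂ν = m * ν.real Set.univ := by rw [hm]; field_simp
  refine ⟨Real.log (ν.real Set.univ), m, fun z => ?_⟩
  rw [Real.le_log_iff_exp_le (integral_exp_inner_pos hk hexp z), sub_eq_add_neg, Real.exp_add,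
    Real.exp_log hνpos]
  have hpt : ∀ x, Real.exp (-(m * ‖z‖)) * (1 + m * ‖z‖ - ‖z‖ * ‖k x‖) ≤
      Real.exp (inner ℝ (k x) z) := by
    intro x
    have h1 : Real.exp (inner ℝ (k x) z) =
        Real.exp (-(m * ‖z‖)) * Real.exp (inner ℝ (k x) z + m * ‖z‖) := by
      rw [← Real.exp_add]; congr 1; ring
    rw [h1]
    gcongr
    have h2 := Real.add_one_le_exp (inner ℝ (k x) z + m * ‖z‖)
    have h3 := neg_le_of_abs_le (abs_real_inner_le_norm (k x) z)
    linarith [mul_comm ‖k x‖ ‖z‖]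
  have hint : ∫ x, Real.exp (-(m * ‖z‖)) * (1 + m * ‖z‖ - ‖z‖ * ‖k x‖) ∂ν ≤
      ∫ x, Real.exp (inner ℝ (k x) z) ∂ν := integral_mono (((integrable_const (1 + m * ‖z‖)).sub
    (hkn.const_mul ‖z‖)).const_mul (Real.exp (-(m * ‖z‖)))) (integrable_exp_inner hk hexp z) hpt
  refine le_trans (le_of_eq ?_) hint
  rw [integral_const_mul, integral_sub (integrable_const _) (hkn.const_mul _), integral_const_mul,
    integral_const, hmm, smul_eq_mul]
  ring

end LogPartition

/-- The stationarity equation of `‖z‖² / 2 + ∑ i, μ i * log (∫ exp ⟪k i x, z⟫ ∂ν i)` has a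
solution. -/
theorem exists_stationary_log_partition {ι X H : Type*} [Fintype ι] [MeasurableSpace X]
    [NormedAddCommGroup H] [InnerProductSpace ℝ H] [CompleteSpace H]
    (ν : ι → Measure X) [∀ i, NeZero (ν i)] (k : ι → X → H) (μ : ι → ℝ) (hμ : ∀ i, 0 ≤ μ i)
    (hk : ∀ i, AEStronglyMeasurable (k i) (ν i))
    (hexp : ∀ i (R : ℝ), Integrable (fun x => Real.exp (R * ‖k i x‖)) (ν i)) :
    ∃ z : H, ∀ h : H, inner ℝ z h + ∑ i, μ i *
      ((∫ x, Real.exp (inner ℝ (k i x) z) * inner ℝ (k i x) h ∂ν i) /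
        ∫ x, Real.exp (inner ℝ (k i x) z) ∂ν i) = 0 := by
  set F : ι → H → ℝ := fun i z => ∫ x, Real.exp (inner ℝ (k i x) z) ∂ν i with hF
  have hFpos : ∀ i z, 0 < F i z := fun i z => integral_exp_inner_pos (hk i) (hexp i) z
  set J : H → ℝ := fun z => ‖z‖ ^ 2 / 2 + ∑ i, μ i * Real.log (F i z) with hJ
  obtain ⟨z, hz⟩ : ∃ z, ∀ w, J z ≤ J w := by
    refine exists_forall_le_of_strongly_midpoint_convex ?_ ?_ ?_
    · refine ((continuous_norm.pow 2).div_const 2).add (continuous_finsetSum _ fun i _ => ?_)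
      exact continuous_const.mul ((continuous_integral_exp_inner (hk i) (hexp i)).log
        fun z => (hFpos i z).ne')
    · choose B C hBC using fun i => exists_log_integral_exp_inner_ge (hk i) (hexp i)
      refine ⟨∑ i, μ i * B i - (∑ i, μ i * C i) ^ 2 / 2, ?_⟩
      rintro _ ⟨z, rfl⟩
      have h1 : ∑ i, μ i * (B i - C i * ‖z‖) ≤ ∑ i, μ i * Real.log (F i z) :=
        Finset.sum_le_sum fun i _ => mul_le_mul_of_nonneg_left (hBC i z) (hμ i)
      have h2 : ∑ i, μ i * (B i - C i * ‖z‖) = ∑ i, μ i * B i - (∑ i, μ i * C i) * ‖z‖ := by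
        rw [Finset.sum_mul, ← Finset.sum_sub_distrib]
        exact Finset.sum_congr rfl fun i _ => by ring
      simp only [hJ]
      nlinarith [sq_nonneg (‖z‖ - ∑ i, μ i * C i)]
    · intro z w
      have h1 : ∑ i, μ i * Real.log (F i ((1 / 2 : ℝ) • (z + w))) ≤
          ∑ i, μ i * ((Real.log (F i z) + Real.log (F i w)) / 2) :=
        Finset.sum_le_sum fun i _ => mul_le_mul_of_nonneg_left
          (log_integral_exp_inner_midpoint_le (hk i) (hexp i) z w) (hμ i)
      have h2 : ∑ i, μ i * ((Real.log (F i z) + Real.log (F i w)) / 2) =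
          (∑ i, μ i * Real.log (F i z) + ∑ i, μ i * Real.log (F i w)) / 2 := by
        rw [← Finset.sum_add_distrib, Finset.sum_div]
        exact Finset.sum_congr rfl fun i _ => by ring
      have h3 := parallelogram_law_with_norm ℝ z w
      have h4 : ‖(1 / 2 : ℝ) • (z + w)‖ ^ 2 = ‖z + w‖ ^ 2 / 4 := by
        rw [norm_smul, mul_pow]; norm_num; ring
      simp only [hJ]
      nlinarith
  refine ⟨z, fun h => ?_⟩
  have hd : HasDerivAt (fun t : ℝ => J (z + t • h)) (inner ℝ z h + ∑ i, μ i *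
      ((∫ x, Real.exp (inner ℝ (k i x) z) * inner ℝ (k i x) h ∂ν i) / F i z)) 0 := by
    refine HasDerivAt.add ?_ (HasDerivAt.fun_sum fun i _ => HasDerivAt.const_mul _ ?_)
    · have h0 : HasDerivAt (fun t : ℝ => z + t • h) h 0 := by
        simpa using ((hasDerivAt_id (0 : ℝ)).smul_const h).const_add z
      have := h0.norm_sq.div_const 2
      simpa using this
    · have := (hasDerivAt_integral_exp_inner (hk i) (hexp i) z h).log
        (by simpa using (hFpos i z).ne')
      simpa using this
  have hmin : IsLocalMin (fun t : ℝ => J (z + t • h)) 0 :=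
    Eventually.of_forall fun t => by simpa using hz (z + t • h)
  exact hmin.hasDerivAt_eq_zero hd

/-! ### Potentials with kernel `|x - y|` and asymptotes -/

section Potential

variable {ρ : ℝ → ℝ}

theorem integrable_abs_sub_mul (h0 : Integrable ρ) (h1 : Integrable fun y => |y| * ρ y) (x : ℝ) :
    Integrable fun y => |x - y| * ρ y := by
  refine ((h0.norm.const_mul |x|).add h1.norm).mono'
    ((by fun_prop : Continuous fun y : ℝ => |x - y|).aestronglyMeasurable.mul h0.1)
    (Eventually.of_forall fun y => ?_)
  simp only [norm_mul, Real.norm_eq_abs, abs_abs, Pi.add_apply]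
  nlinarith [abs_sub x y, abs_nonneg (ρ y)]

/-- The derivative is `∫ sign (x - y) ρ y`. The kink at `y = x` is a null set, so the Lipschitz form
of differentiation under the integral applies. -/
theorem hasDerivAt_integral_abs_sub_mul (h0 : Integrable ρ)
    (h1 : Integrable fun y => |y| * ρ y) (x : ℝ) :
    HasDerivAt (fun x => ∫ y, |x - y| * ρ y) (2 * (∫ y in Set.Iic x, ρ y) - ∫ y, ρ y) x := by
  have hs : 2 * (∫ y in Set.Iic x, ρ y) - ∫ y, ρ y =
      ∫ y, ((Set.Iic x).indicator (fun y => 2 * ρ y) y - ρ y) := by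
    rw [integral_sub ((h0.const_mul 2).indicator measurableSet_Iic) h0,
      integral_indicator measurableSet_Iic, integral_const_mul]
  rw [hs]
  refine (hasDerivAt_integral_of_dominated_loc_of_lip (μ := volume) (s := Set.univ)
    (F := fun x y => |x - y| * ρ y) (bound := fun y => |ρ y|) univ_mem
    (Eventually.of_forall fun x => (integrable_abs_sub_mul h0 h1 x).1)
    (integrable_abs_sub_mul h0 h1 x)
    (((h0.const_mul 2).indicator measurableSet_Iic).sub h0).1 ?_ h0.abs ?_).2
  · refine Eventually.of_forall fun y => LipschitzOnWith.of_dist_le_mul fun a _ b _ => ?_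
    rw [Real.dist_eq, Real.dist_eq, ← sub_mul, abs_mul, Real.coe_nnabs, abs_abs, mul_comm]
    have := abs_abs_sub_abs_le_abs_sub (a - y) (b - y)
    rw [sub_sub_sub_cancel_right] at this
    exact mul_le_mul_of_nonneg_left this (abs_nonneg _)
  · filter_upwards [Measure.ae_ne volume x] with y hy
    rcases lt_or_gt_of_ne hy with h | h
    · have hd : HasDerivAt (fun x => (x - y) * ρ y) (1 * ρ y) x :=
        ((hasDerivAt_id x).sub_const y).mul_const _
      have he : (fun x => |x - y| * ρ y) =ᶠ[𝓝 x] fun x => (x - y) * ρ y := by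
        filter_upwards [lt_mem_nhds h] with a ha
        rw [abs_of_pos (sub_pos.2 ha)]
      convert hd.congr_of_eventuallyEq he using 1
      rw [Pi.sub_apply, Set.indicator_of_mem (show y ∈ Set.Iic x from h.le)]
      ring
    · have hd : HasDerivAt (fun x => -(x - y) * ρ y) (-1 * ρ y) x :=
        (((hasDerivAt_id x).sub_const y).neg).mul_const _
      have he : (fun x => |x - y| * ρ y) =ᶠ[𝓝 x] fun x => -(x - y) * ρ y := by
        filter_upwards [gt_mem_nhds h] with a ha
        rw [abs_of_neg (sub_neg.2 ha)]
      convert hd.congr_of_eventuallyEq he using 1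
      rw [Pi.sub_apply, Set.indicator_of_notMem (by simpa using h)]
      ring

theorem hasDerivAt_integral_Iic (hc : Continuous ρ) (h0 : Integrable ρ) (x : ℝ) :
    HasDerivAt (fun x => ∫ y in Set.Iic x, ρ y) (ρ x) x := by
  have he : (fun x => ∫ y in Set.Iic x, ρ y) =
      fun x => (∫ y in (0 : ℝ)..x, ρ y) + ∫ y in Set.Iic 0, ρ y := by
    funext x
    rw [← intervalIntegral.integral_Iic_sub_Iic h0.integrableOn h0.integrableOn]
    ring
  rw [he]
  exact (hc.integral_hasStrictDerivAt 0 x).hasDerivAt.add_const _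

theorem abs_integral_abs_sub_mul_sub_le (h0 : Integrable ρ) (h1 : Integrable fun y => |y| * ρ y)
    (x : ℝ) : |(∫ y, |x - y| * ρ y) - |x| * ∫ y, ρ y| ≤ ∫ y, |y| * |ρ y| := by
  rw [← integral_const_mul, ← integral_sub (integrable_abs_sub_mul h0 h1 x) (h0.const_mul _)]
  refine (abs_integral_le_integral_abs).trans (integral_mono_of_nonneg
    (Eventually.of_forall fun y => abs_nonneg _) (by simpa [abs_mul] using h1.abs)
    (Eventually.of_forall fun y => ?_))
  simp only
  rw [← sub_mul, abs_mul]
  have := abs_abs_sub_abs_le_abs_sub (x - y) x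
  rw [sub_sub_cancel_left, abs_neg] at this
  exact mul_le_mul_of_nonneg_right this (abs_nonneg _)

/-- A function on the line whose second derivative is integrable against `1 + |x|` has an
asymptote at each end. -/
theorem exists_asymptotes {w w' : ℝ → ℝ} (hc : Continuous ρ) (h0 : Integrable ρ)
    (h1 : Integrable fun y => |y| * ρ y) (hw : ∀ x, HasDerivAt w (w' x) x)
    (hw' : ∀ x, HasDerivAt w' (ρ x) x) :
    ∃ b C : ℝ, ∀ x, |w x - (b * x + |x| * (∫ y, ρ y) / 2)| ≤ C := by
  set N : ℝ → ℝ := fun x => ∫ y, |x - y| * ρ y with hN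
  set S : ℝ → ℝ := fun x => ∫ y in Set.Iic x, ρ y with hS
  set I : ℝ := ∫ y, ρ y with hI
  have hS' : ∀ x, HasDerivAt S (ρ x) x := hasDerivAt_integral_Iic hc h0
  have hN' : ∀ x, HasDerivAt N (2 * S x - I) x := hasDerivAt_integral_abs_sub_mul h0 h1
  have hb : ∀ x, w' x - S x = w' 0 - S 0 := fun x =>
    is_const_of_deriv_eq_zero (f := fun x => w' x - S x)
      (fun x => ((hw' x).sub (hS' x)).differentiableAt)
      (fun x => by rw [((hw' x).fun_sub (hS' x)).deriv, sub_self]) x 0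
  set b := w' 0 - S 0 + I / 2 with hbdef
  have hd : ∀ x, HasDerivAt (fun x => w x - N x / 2 - b * x) 0 x := by
    intro x
    refine (((hw x).sub ((hN' x).div_const 2)).sub ((hasDerivAt_id x).const_mul b)).congr_deriv ?_
    linarith [hb x]
  -- Half the potential `N` has second derivative `ρ`, so it differs from `w` by an affine function;
  -- and `N` is `|x| ∫ ρ` up to a bounded error.
  have ha : ∀ x, w x - N x / 2 - b * x = w 0 - N 0 / 2 - b * 0 := fun x =>
    is_const_of_deriv_eq_zero (f := fun x => w x - N x / 2 - b * x)
      (fun x => (hd x).differentiableAt) (fun x => (hd x).deriv) x 0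
  refine ⟨b, |w 0 - N 0 / 2| + (∫ y, |y| * |ρ y|) / 2, fun x => ?_⟩
  have h2 := abs_integral_abs_sub_mul_sub_le h0 h1 x
  have h3 : w x - (b * x + |x| * I / 2) = (w 0 - N 0 / 2) + (N x - |x| * I) / 2 := by
    linarith [ha x]
  rw [h3]
  refine (abs_add_le _ _).trans ?_
  rw [abs_div, abs_two]
  gcongr

end Potential

/-! ### The kernel as a Gram kernel -/

/-- The element of `L²(ℝ)` given by the indicator function of the interval between `0` and `x`. -/
noncomputable def intervalIndicatorLp (x : ℝ) : Lp ℝ 2 (volume : Measure ℝ) :=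
  indicatorConstLp 2 (s := Set.uIoc 0 x) measurableSet_uIoc (by rw [Set.uIoc]; exact measure_Ioc_lt_top.ne) 1

/-- The overlap of the two intervals has length `min |x| |y|` when `x` and `y` have the same sign
and 0 otherwise: the covariance of two-sided Brownian motion. -/
theorem inner_intervalIndicatorLp (x y : ℝ) :
    inner ℝ (intervalIndicatorLp x) (intervalIndicatorLp y) = (|x| + |y| - |x - y|) / 2 := by
  unfold intervalIndicatorLp
  have hfin : ∀ a : ℝ, volume (Set.uIoc 0 a) ≠ ⊤ := fun a => by
    rw [Set.uIoc]; exact measure_Ioc_lt_top.ne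
  rw [L2.inner_indicatorConstLp_indicatorConstLp measurableSet_uIoc measurableSet_uIoc (hfin x)
    (hfin y)]
  simp only [inner_self_eq_norm_sq_to_K, norm_one]
  rcases le_total 0 x with hx | hx <;> rcases le_total 0 y with hy | hy
  · rw [Set.uIoc_of_le hx, Set.uIoc_of_le hy, Set.Ioc_inter_Ioc]
    rcases le_total x y with h | h <;>
      simp [measureReal_def, hx, hy, h, abs_of_nonneg, abs_of_nonpos, sub_nonneg] <;> ring
  · rw [Set.uIoc_of_le hx, Set.uIoc_of_ge hy, Set.Ioc_inter_Ioc]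
    simp [measureReal_def, hx, hy, abs_of_nonneg, abs_of_nonpos, sub_nonneg.2 (hy.trans hx)]
  · rw [Set.uIoc_of_ge hx, Set.uIoc_of_le hy, Set.Ioc_inter_Ioc]
    simp [measureReal_def, hx, hy, abs_of_nonneg, abs_of_nonpos, sub_nonpos.2 (hx.trans hy)]
    ring
  · rw [Set.uIoc_of_ge hx, Set.uIoc_of_ge hy, Set.Ioc_inter_Ioc]
    rcases le_total x y with h | h <;>
      simp [measureReal_def, hx, hy, h, abs_of_nonneg, abs_of_nonpos, sub_nonneg] <;> ring

theorem norm_sq_intervalIndicatorLp (x : ℝ) : ‖intervalIndicatorLp x‖ ^ 2 = |x| := by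
  rw [← real_inner_self_eq_norm_sq, inner_intervalIndicatorLp]
  simp

theorem continuous_intervalIndicatorLp : Continuous intervalIndicatorLp := by
  have hsq : ∀ x y, ‖intervalIndicatorLp x - intervalIndicatorLp y‖ ^ 2 = |x - y| := by
    intro x y
    rw [norm_sub_sq_real, norm_sq_intervalIndicatorLp, norm_sq_intervalIndicatorLp,
      inner_intervalIndicatorLp]
    ring
  refine continuous_iff_continuousAt.2 fun x => ?_
  rw [ContinuousAt, tendsto_iff_norm_sub_tendsto_zero]
  have h1 : Tendsto (fun y => Real.sqrt |y - x|) (𝓝 x) (𝓝 (Real.sqrt |x - x|)) :=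
    Continuous.tendsto (by fun_prop) x
  simp only [sub_self, abs_zero, Real.sqrt_zero] at h1
  refine h1.congr fun y => ?_
  rw [← hsq, Real.sqrt_sq (norm_nonneg _)]

/-- A function on the line which is convex and bounded above has vanishing second derivative. -/
theorem second_deriv_eq_zero_of_convex_of_le {f f' f'' : ℝ → ℝ} {C : ℝ}
    (hf : ∀ x, HasDerivAt f (f' x) x) (hf' : ∀ x, HasDerivAt f' (f'' x) x)
    (hnn : ∀ x, 0 ≤ f'' x) (hC : ∀ x, f x ≤ C) (x : ℝ) : f'' x = 0 := by
  have hmono : Monotone f' := monotone_of_deriv_nonneg (fun x => (hf' x).differentiableAt)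
    fun x => by rw [(hf' x).deriv]; exact hnn x
  have hcont : Continuous f := continuous_iff_continuousAt.2 fun x => (hf x).continuousAt
  have htan : ∀ a x, f a + f' a * (x - a) ≤ f x := by
    intro a x
    rcases lt_trichotomy a x with h | rfl | h
    · obtain ⟨c, hc, hs⟩ := exists_hasDerivAt_eq_slope f f' h hcont.continuousOn fun y _ => hf y
      rw [eq_div_iff (sub_pos.2 h).ne'] at hs
      nlinarith [hmono hc.1.le]
    · simp
    · obtain ⟨c, hc, hs⟩ := exists_hasDerivAt_eq_slope f f' h hcont.continuousOn fun y _ => hf y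
      rw [eq_div_iff (sub_pos.2 h).ne'] at hs
      nlinarith [hmono hc.2.le]
  have h0 : ∀ a, f' a = 0 := by
    intro a
    by_contra hne
    -- At this point the tangent line at `a` reaches `C + 1`.
    have h1 := htan a (a + (C - f a + 1) / f' a)
    rw [add_sub_cancel_left, mul_div_cancel₀ _ hne] at h1
    linarith [hC (a + (C - f a + 1) / f' a)]
  have h1 : f' = fun _ => 0 := funext h0
  have h2 := hf' x
  rw [h1] at h2
  exact h2.unique (hasDerivAt_const x 0)

/-! ### Decay as a global bound on logarithms -/

/-- The exponent with slope `α` at `+∞` and `-β` at `-∞`, up to the Gaussian term. -/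
noncomputable def decayProfile (e ξ α β x : ℝ) : ℝ :=
  (α - β) / 2 * x + (α + β) / 2 * |x| - e ^ 2 * ξ * x ^ 2 / 2

theorem continuous_decayProfile (e ξ α β : ℝ) : Continuous (decayProfile e ξ α β) := by
  unfold decayProfile; fun_prop

theorem decayProfile_eventuallyEq_atTop (e ξ α β : ℝ) :
    decayProfile e ξ α β =ᶠ[atTop] fun x => α * x - e ^ 2 * ξ * x ^ 2 / 2 := by
  filter_upwards [eventually_ge_atTop 0] with x hx
  rw [decayProfile, abs_of_nonneg hx]; ring

theorem decayProfile_eventuallyEq_atBot (e ξ α β : ℝ) :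
    decayProfile e ξ α β =ᶠ[atBot] fun x => -β * x - e ^ 2 * ξ * x ^ 2 / 2 := by
  filter_upwards [eventually_le_atBot 0] with x hx
  rw [decayProfile, abs_of_nonpos hx]; ring

theorem integrable_exp_decayProfile {e ξ : ℝ} (he : 0 < e) (hξ : 0 < ξ) (α β R : ℝ) :
    Integrable fun x => Real.exp (decayProfile e ξ α β x + R * |x|) := by
  -- Half of the Gaussian coefficient: the other half absorbs all terms linear in `|x|` by
  -- completing the square.
  set a := e ^ 2 * ξ / 4 with ha
  have hapos : 0 < a := by positivity
  set b := |α - β| / 2 + |α + β| / 2 + |R| with hb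
  refine ((integrable_exp_neg_mul_sq hapos).const_mul (Real.exp (b ^ 2 / (4 * a)))).mono'
    (by have := continuous_decayProfile e ξ α β; fun_prop) (Eventually.of_forall fun x => ?_)
  rw [Real.norm_of_nonneg (Real.exp_pos _).le, ← Real.exp_add, Real.exp_le_exp, decayProfile]
  have h1 : (α - β) * x ≤ |α - β| * |x| := (le_abs_self _).trans (abs_mul _ _).le
  have h2 : (α + β) * |x| ≤ |α + β| * |x| := by gcongr; exact le_abs_self _
  have h3 : R * |x| ≤ |R| * |x| := by gcongr; exact le_abs_self _
  have h4 : b * |x| ≤ b ^ 2 / (4 * a) + a * x ^ 2 := by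
    rw [← sq_abs x, ← sub_nonneg]
    have : b ^ 2 / (4 * a) + a * |x| ^ 2 - b * |x| = (b - 2 * a * |x|) ^ 2 / (4 * a) := by
      field_simp; ring
    rw [this]; positivity
  have h5 : e ^ 2 * ξ * x ^ 2 / 2 = 2 * a * x ^ 2 := by rw [ha]; ring
  rw [h5]
  have h6 : b * |x| = |α - β| * |x| / 2 + |α + β| * |x| / 2 + |R| * |x| := by rw [hb]; ring
  linarith

theorem exists_forall_le_of_isBoundedUnder {f : ℝ → ℝ} (hf : Continuous f)
    (htop : IsBoundedUnder (· ≤ ·) atTop f) (hbot : IsBoundedUnder (· ≤ ·) atBot f) :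
    ∃ C, ∀ x, f x ≤ C := by
  obtain ⟨C₁, h₁⟩ := htop
  obtain ⟨C₂, h₂⟩ := hbot
  obtain ⟨a, ha⟩ := eventually_atTop.1 (eventually_map.1 h₁)
  obtain ⟨b, hb⟩ := eventually_atBot.1 (eventually_map.1 h₂)
  obtain ⟨C₃, h₃⟩ := (isCompact_Icc (a := b) (b := a)).bddAbove_image hf.continuousOn
  refine ⟨max C₁ (max C₂ C₃), fun x => ?_⟩
  rcases le_total a x with h | h
  · exact (ha x h).trans (le_max_left _ _)
  · rcases le_total x b with h' | h'
    · exact (hb x h').trans ((le_max_left _ _).trans (le_max_right _ _))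
    · exact (h₃ ⟨x, ⟨h', h⟩, rfl⟩).trans ((le_max_right _ _).trans (le_max_right _ _))

theorem isBigO_exp_atTop_and_atBot_iff {f g : ℝ → ℝ} (hf : Continuous f) (hg : Continuous g) :
    (((fun x => Real.exp (f x)) =O[atTop] fun x => Real.exp (g x)) ∧
      (fun x => Real.exp (f x)) =O[atBot] fun x => Real.exp (g x)) ↔
      ∃ C, ∀ x, f x - g x ≤ C := by
  rw [Real.isBigO_exp_comp_exp_comp, Real.isBigO_exp_comp_exp_comp]
  constructor
  · rintro ⟨h1, h2⟩
    exact exists_forall_le_of_isBoundedUnder (hf.sub hg) h1 h2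
  · rintro ⟨C, hC⟩
    exact ⟨isBoundedUnder_of ⟨C, hC⟩, isBoundedUnder_of ⟨C, hC⟩⟩

section Decay

variable {e ξ α β : ℝ} {q : ℝ → ℝ}

theorem exp_two_mul_log {a : ℝ} (ha : 0 < a) : Real.exp (2 * Real.log a) = a ^ 2 := by
  rw [two_mul, Real.exp_add, Real.exp_log ha, sq]

theorem hasDecay_iff (hq : Continuous q) (hpos : ∀ x, 0 < q x) :
    HasDecay e ξ α β q ↔ ∃ C, ∀ x, 2 * Real.log (q x) - decayProfile e ξ α β x ≤ C := by
  have hlog : Continuous fun x => 2 * Real.log (q x) :=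
    continuous_const.mul (hq.log fun x => (hpos x).ne')
  rw [← isBigO_exp_atTop_and_atBot_iff hlog (continuous_decayProfile e ξ α β)]
  simp only [exp_two_mul_log (hpos _)]
  exact and_congr
    (isBigO_congr EventuallyEq.rfl ((decayProfile_eventuallyEq_atTop e ξ α β).fun_comp Real.exp).symm)
    (isBigO_congr EventuallyEq.rfl ((decayProfile_eventuallyEq_atBot e ξ α β).fun_comp Real.exp).symm)

theorem hasSharpDecay_iff (hq : Continuous q) (hpos : ∀ x, 0 < q x) :
    HasSharpDecay e ξ α β q ↔ ∃ C, ∀ x, |2 * Real.log (q x) - decayProfile e ξ α β x| ≤ C := by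
  have hlog : Continuous fun x => 2 * Real.log (q x) :=
    continuous_const.mul (hq.log fun x => (hpos x).ne')
  have h1 := hasDecay_iff (e := e) (ξ := ξ) (α := α) (β := β) hq hpos
  have h2 := isBigO_exp_atTop_and_atBot_iff (continuous_decayProfile e ξ α β) hlog
  simp only [exp_two_mul_log (hpos _)] at h2
  have h3 : HasSharpDecay e ξ α β q ↔ HasDecay e ξ α β q ∧
      ((fun x => Real.exp (decayProfile e ξ α β x)) =O[atTop] fun x => q x ^ 2) ∧
      (fun x => Real.exp (decayProfile e ξ α β x)) =O[atBot] fun x => q x ^ 2 := by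
    have ht := isBigO_congr ((decayProfile_eventuallyEq_atTop e ξ α β).fun_comp Real.exp)
      (EventuallyEq.refl _ fun x => q x ^ 2)
    have hb := isBigO_congr ((decayProfile_eventuallyEq_atBot e ξ α β).fun_comp Real.exp)
      (EventuallyEq.refl _ fun x => q x ^ 2)
    unfold HasSharpDecay HasDecay IsTheta
    simp only [Function.comp_def] at ht hb
    rw [ht, hb]
    tauto
  rw [h3, h1, h2]
  constructor
  · rintro ⟨⟨C, hC⟩, D, hD⟩
    refine ⟨max C D, fun x => abs_le'.2 ⟨(hC x).trans (le_max_left _ _), ?_⟩⟩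
    rw [neg_sub]
    exact (hD x).trans (le_max_right _ _)
  · rintro ⟨C, hC⟩
    exact ⟨⟨C, fun x => (le_abs_self _).trans (hC x)⟩, C, fun x => by
      rw [← neg_sub]; exact (neg_le_abs _).trans (hC x)⟩

theorem HasSharpDecay.hasDecay (h : HasSharpDecay e ξ α β q) : HasDecay e ξ α β q :=
  ⟨h.1.1, h.2.1⟩

theorem HasDecay.integrable (he : 0 < e) (hξ : 0 < ξ) (hq : Continuous q) (hpos : ∀ x, 0 < q x)
    (h : HasDecay e ξ α β q) :
    Integrable (fun x => q x ^ 2) ∧ Integrable fun x => |x| * q x ^ 2 := by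
  obtain ⟨C, hC⟩ := (hasDecay_iff hq hpos).1 h
  have hle : ∀ x, q x ^ 2 ≤ Real.exp C * Real.exp (decayProfile e ξ α β x) := fun x => by
    rw [← exp_two_mul_log (hpos x), ← Real.exp_add, Real.exp_le_exp]
    linarith [hC x]
  constructor
  · refine ((integrable_exp_decayProfile he hξ α β 0).const_mul (Real.exp C)).mono'
      (by fun_prop) (Eventually.of_forall fun x => ?_)
    rw [Real.norm_of_nonneg (by positivity), zero_mul, add_zero]
    exact hle x
  · refine ((integrable_exp_decayProfile he hξ α β 1).const_mul (Real.exp C)).mono'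
      (by fun_prop) (Eventually.of_forall fun x => ?_)
    rw [Real.norm_of_nonneg (by positivity), one_mul, Real.exp_add, ← mul_assoc, mul_comm]
    refine mul_le_mul (hle x) ?_ (abs_nonneg x) (by positivity)
    linarith [Real.add_one_le_exp |x|]

end Decay

theorem slopes_nonpos_of_le {s t C : ℝ} (h : ∀ x, t * x + |x| * s ≤ C) : s + t ≤ 0 ∧ s - t ≤ 0 := by
  have key : ∀ r : ℝ, (∀ x, 0 ≤ x → r * x ≤ C) → r ≤ 0 := by
    intro r hr
    by_contra! hlt
    have := hr ((|C| + 1) / r) (by positivity)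
    rw [mul_div_cancel₀ _ hlt.ne'] at this
    linarith [le_abs_self C]
  constructor
  · refine key _ fun x hx => ?_
    have := h x
    rw [abs_of_nonneg hx] at this
    linarith
  · refine key _ fun x hx => ?_
    have := h (-x)
    rw [abs_neg, abs_of_nonneg hx] at this
    linarith

/-! ### Asymptotics, exact integrals and uniqueness -/

section DomainWall

variable {e γ ξ α₁ α₂ β₁ β₂ : ℝ} {q₁ q₂ p₁ p₂ : ℝ → ℝ}

theorem IsDomainWall.symm (h : IsDomainWall e γ ξ q₁ q₂) : IsDomainWall e γ ξ q₂ q₁ where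
  contDiff₁ := h.contDiff₂
  contDiff₂ := h.contDiff₁
  pos₁ := h.pos₂
  pos₂ := h.pos₁
  eqn₁ x := by rw [h.eqn₂]; ring
  eqn₂ x := by rw [h.eqn₁]; ring
  tendsto_atTop₁ := h.tendsto_atTop₂
  tendsto_atTop₂ := h.tendsto_atTop₁
  tendsto_atBot₁ := h.tendsto_atBot₂
  tendsto_atBot₂ := h.tendsto_atBot₁

theorem IsDomainWall.hasDerivAt_log (h : IsDomainWall e γ ξ q₁ q₂) (x : ℝ) :
    HasDerivAt (fun y => Real.log (q₁ y)) (deriv (fun y => Real.log (q₁ y)) x) x ∧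
    HasDerivAt (deriv fun y => Real.log (q₁ y))
      (e ^ 2 / 4 * ((1 + γ) * q₁ x ^ 2 + (1 - γ) * q₂ x ^ 2 - 2 * ξ)) x := by
  have hc : ContDiff ℝ 2 fun y => Real.log (q₁ y) := h.contDiff₁.log fun x => (h.pos₁ x).ne'
  have hc' : ContDiff ℝ 1 (deriv fun y => Real.log (q₁ y)) :=
    ((contDiff_succ_iff_deriv (n := 1)).1 hc).2.2
  refine ⟨((hc.differentiable (by norm_num)) x).hasDerivAt, ?_⟩
  rw [← h.eqn₁]
  exact ((hc'.differentiable (by norm_num)) x).hasDerivAt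

theorem IsDomainWall.exists_asymptotes (he : 0 < e) (hξ : 0 < ξ) (h : IsDomainWall e γ ξ q₁ q₂)
    (h₁ : HasDecay e ξ α₁ β₁ q₁) (h₂ : HasDecay e ξ α₂ β₂ q₂) :
    ∃ b C : ℝ, ∀ x, |2 * Real.log (q₁ x) - decayProfile e ξ α₁ β₁ x - (b * x + |x| *
      ((e ^ 2 / 2 * ((1 + γ) * (∫ y, q₁ y ^ 2) + (1 - γ) * ∫ y, q₂ y ^ 2) - (α₁ + β₁)) / 2))| ≤
        C := by
  have hq₁ := h.contDiff₁.continuous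
  have hq₂ := h.contDiff₂.continuous
  obtain ⟨i1, j1⟩ := h₁.integrable he hξ hq₁ h.pos₁
  obtain ⟨i2, j2⟩ := h₂.integrable he hξ hq₂ h.pos₂
  set g : ℝ → ℝ := fun x => e ^ 2 / 2 * ((1 + γ) * q₁ x ^ 2 + (1 - γ) * q₂ x ^ 2) with hg
  have hgi : Integrable g := ((i1.const_mul _).add (i2.const_mul _)).const_mul _
  have hgj : Integrable fun x => |x| * g x := by
    refine (((j1.const_mul (1 + γ)).add (j2.const_mul (1 - γ))).const_mul (e ^ 2 / 2)).congr
      (Eventually.of_forall fun x => ?_)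
    simp only [hg, Pi.add_apply]; ring
  have hgint : ∫ x, g x =
      e ^ 2 / 2 * ((1 + γ) * (∫ y, q₁ y ^ 2) + (1 - γ) * ∫ y, q₂ y ^ 2) := by
    simp only [hg]
    rw [integral_const_mul, integral_add (i1.const_mul _) (i2.const_mul _), integral_const_mul,
      integral_const_mul]
  -- Adding `e² ξ x² / 2` removes the constant `-2 ξ`, leaving an integrable second derivative `g`.
  obtain ⟨b, C, hbC⟩ := _root_.exists_asymptotes (ρ := g)
    (w := fun x => 2 * Real.log (q₁ x) + e ^ 2 * ξ / 2 * x ^ 2)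
    (w' := fun x => 2 * deriv (fun y => Real.log (q₁ y)) x + e ^ 2 * ξ * x)
    (by fun_prop) hgi hgj
    (fun x => (((h.hasDerivAt_log x).1.const_mul 2).add
      ((hasDerivAt_pow 2 x).const_mul (e ^ 2 * ξ / 2))).congr_deriv (by simp; ring))
    (fun x => (((h.hasDerivAt_log x).2.const_mul 2).add
      ((hasDerivAt_id x).const_mul (e ^ 2 * ξ))).congr_deriv (by simp only [hg]; ring))
  refine ⟨b - (α₁ - β₁) / 2, C, fun x => ?_⟩
  rw [← hgint]
  convert hbC x using 2
  rw [decayProfile]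
  ring

/-- Two-sided bounds make `b x + |x| s` bounded both above and below, hence `s = 0`. -/
theorem IsDomainWall.balance (he : 0 < e) (hξ : 0 < ξ) (h : IsDomainWall e γ ξ q₁ q₂)
    (h₁ : HasSharpDecay e ξ α₁ β₁ q₁) (h₂ : HasDecay e ξ α₂ β₂ q₂) :
    e ^ 2 / 2 * ((1 + γ) * (∫ y, q₁ y ^ 2) + (1 - γ) * ∫ y, q₂ y ^ 2) = α₁ + β₁ := by
  obtain ⟨b, C, hbC⟩ := h.exists_asymptotes he hξ h₁.hasDecay h₂
  obtain ⟨D, hD⟩ := (hasSharpDecay_iff h.contDiff₁.continuous h.pos₁).1 h₁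
  set s := (e ^ 2 / 2 * ((1 + γ) * (∫ y, q₁ y ^ 2) + (1 - γ) * ∫ y, q₂ y ^ 2) - (α₁ + β₁)) / 2
    with hs
  have k1 := slopes_nonpos_of_le (s := s) (t := b) (C := C + D) fun x => by
    linarith [abs_le.1 (hbC x), abs_le.1 (hD x)]
  have k2 := slopes_nonpos_of_le (s := -s) (t := -b) (C := C + D) fun x => by
    linarith [abs_le.1 (hbC x), abs_le.1 (hD x)]
  linarith [k1.1, k1.2, k2.1, k2.2]

/-- The balance removes the `|x|` term; an upper bound on `b x` at both ends then forces `b = 0`,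
and the asymptote becomes a two-sided bound. -/
theorem IsDomainWall.hasSharpDecay (he : 0 < e) (hξ : 0 < ξ) (h : IsDomainWall e γ ξ q₁ q₂)
    (h₁ : HasDecay e ξ α₁ β₁ q₁) (h₂ : HasDecay e ξ α₂ β₂ q₂)
    (hbal : e ^ 2 / 2 * ((1 + γ) * (∫ y, q₁ y ^ 2) + (1 - γ) * ∫ y, q₂ y ^ 2) = α₁ + β₁) :
    HasSharpDecay e ξ α₁ β₁ q₁ := by
  obtain ⟨b, C, hbC⟩ := h.exists_asymptotes he hξ h₁ h₂
  obtain ⟨D, hD⟩ := (hasDecay_iff h.contDiff₁.continuous h.pos₁).1 h₁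
  simp only [hbal, sub_self, zero_div] at hbC
  have k1 := slopes_nonpos_of_le (s := 0) (t := b) (C := C + D) fun x => by
    linarith [abs_le.1 (hbC x), hD x]
  have hb : b = 0 := by linarith [k1.1, k1.2]
  refine (hasSharpDecay_iff h.contDiff₁.continuous h.pos₁).2 ⟨C, fun x => ?_⟩
  simpa [hb] using hbC x

theorem log_sub_log_mul_nonneg {a b : ℝ} (ha : 0 < a) (hb : 0 < b) :
    0 ≤ (Real.log a - Real.log b) * (a ^ 2 - b ^ 2) := by
  rcases le_total a b with h | h
  · exact mul_nonneg_of_nonpos_of_nonpos (sub_nonpos.2 (Real.log_le_log ha h))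
      (sub_nonpos.2 (by gcongr))
  · exact mul_nonneg (sub_nonneg.2 (Real.log_le_log hb h)) (sub_nonneg.2 (by gcongr))

theorem eq_of_log_sub_log_mul_eq_zero {a b : ℝ} (ha : 0 < a) (hb : 0 < b)
    (h : (Real.log a - Real.log b) * (a ^ 2 - b ^ 2) = 0) : a = b := by
  rcases mul_eq_zero.1 h with h | h
  · exact Real.log_injOn_pos ha hb (sub_eq_zero.1 h)
  · exact (pow_left_inj₀ ha.le hb.le two_ne_zero).1 (sub_eq_zero.1 h)

theorem IsDomainWall.eq_of_hasSharpDecay (he : 0 < e) (hγ : 0 < γ)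
    (hq : IsDomainWall e γ ξ q₁ q₂) (hp : IsDomainWall e γ ξ p₁ p₂)
    (hq₁ : HasSharpDecay e ξ α₁ β₁ q₁) (hq₂ : HasSharpDecay e ξ α₂ β₂ q₂)
    (hp₁ : HasSharpDecay e ξ α₁ β₁ p₁) (hp₂ : HasSharpDecay e ξ α₂ β₂ p₂) :
    q₁ = p₁ ∧ q₂ = p₂ := by
  obtain ⟨A, hA⟩ := (hasSharpDecay_iff hq.contDiff₁.continuous hq.pos₁).1 hq₁
  obtain ⟨B, hB⟩ := (hasSharpDecay_iff hq.contDiff₂.continuous hq.pos₂).1 hq₂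
  obtain ⟨C, hC⟩ := (hasSharpDecay_iff hp.contDiff₁.continuous hp.pos₁).1 hp₁
  obtain ⟨D, hD⟩ := (hasSharpDecay_iff hp.contDiff₂.continuous hp.pos₂).1 hp₂
  set d₁ : ℝ → ℝ := fun x => Real.log (q₁ x) - Real.log (p₁ x) with hd₁
  set d₂ : ℝ → ℝ := fun x => Real.log (q₂ x) - Real.log (p₂ x) with hd₂
  set d₁' : ℝ → ℝ := fun x => deriv (fun y => Real.log (q₁ y)) x -
    deriv (fun y => Real.log (p₁ y)) x with hd₁'
  set d₂' : ℝ → ℝ := fun x => deriv (fun y => Real.log (q₂ y)) x -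
    deriv (fun y => Real.log (p₂ y)) x with hd₂'
  set F₁ : ℝ → ℝ := fun x => q₁ x ^ 2 - p₁ x ^ 2 with hF₁
  set F₂ : ℝ → ℝ := fun x => q₂ x ^ 2 - p₂ x ^ 2 with hF₂
  have D₁ : ∀ x, HasDerivAt d₁ (d₁' x) x := fun x =>
    (hq.hasDerivAt_log x).1.sub (hp.hasDerivAt_log x).1
  have D₂ : ∀ x, HasDerivAt d₂ (d₂' x) x := fun x =>
    (hq.symm.hasDerivAt_log x).1.sub (hp.symm.hasDerivAt_log x).1
  have E₁ : ∀ x, HasDerivAt d₁' (e ^ 2 / 4 * ((1 + γ) * F₁ x + (1 - γ) * F₂ x)) x := fun x =>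
    ((hq.hasDerivAt_log x).2.sub (hp.hasDerivAt_log x).2).congr_deriv (by simp only [hF₁, hF₂]; ring)
  have E₂ : ∀ x, HasDerivAt d₂' (e ^ 2 / 4 * ((1 + γ) * F₂ x + (1 - γ) * F₁ x)) x := fun x =>
    ((hq.symm.hasDerivAt_log x).2.sub (hp.symm.hasDerivAt_log x).2).congr_deriv
      (by simp only [hF₁, hF₂]; ring)
  have hn₁ : ∀ x, 0 ≤ d₁ x * F₁ x := fun x => log_sub_log_mul_nonneg (hq.pos₁ x) (hp.pos₁ x)
  have hn₂ : ∀ x, 0 ≤ d₂ x * F₂ x := fun x => log_sub_log_mul_nonneg (hq.pos₂ x) (hp.pos₂ x)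
  have hb₁ : ∀ x, |d₁ x| ≤ (A + C) / 2 := fun x => by
    rw [abs_le]
    simp only [hd₁]
    constructor <;> linarith [abs_le.1 (hA x), abs_le.1 (hC x)]
  have hb₂ : ∀ x, |d₂ x| ≤ (B + D) / 2 := fun x => by
    rw [abs_le]
    simp only [hd₂]
    constructor <;> linarith [abs_le.1 (hB x), abs_le.1 (hD x)]
  -- The sum and difference diagonalise the coupling, with eigenvalues in ratio `1 : γ`. The weights
  -- `γ : 1` compensate for this, so the cross terms `d₁ F₂` and `d₂ F₁` cancel in `f''` and only
  -- nonnegative terms remain.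
  have key := second_deriv_eq_zero_of_convex_of_le
    (f := fun x => γ * (d₁ x + d₂ x) ^ 2 + (d₁ x - d₂ x) ^ 2)
    (f' := fun x => 2 * γ * ((d₁ x + d₂ x) * (d₁' x + d₂' x)) +
      2 * ((d₁ x - d₂ x) * (d₁' x - d₂' x)))
    (f'' := fun x => 2 * γ * (d₁' x + d₂' x) ^ 2 + 2 * (d₁' x - d₂' x) ^ 2 +
      2 * e ^ 2 * γ * (d₁ x * F₁ x + d₂ x * F₂ x))
    (C := γ * ((A + C) / 2 + (B + D) / 2) ^ 2 + ((A + C) / 2 + (B + D) / 2) ^ 2) ?_ ?_ ?_ ?_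
  · have hz : ∀ x, d₁ x * F₁ x = 0 ∧ d₂ x * F₂ x = 0 := by
      intro x
      have hx := key x
      have h1 : 0 ≤ 2 * γ * (d₁' x + d₂' x) ^ 2 := by positivity
      have h2 : 0 ≤ 2 * (d₁' x - d₂' x) ^ 2 := by positivity
      have h3 : 0 < 2 * e ^ 2 * γ := by positivity
      have h4 : 0 ≤ 2 * e ^ 2 * γ * (d₁ x * F₁ x + d₂ x * F₂ x) :=
        mul_nonneg h3.le (add_nonneg (hn₁ x) (hn₂ x))
      have h5 : 2 * e ^ 2 * γ * (d₁ x * F₁ x + d₂ x * F₂ x) = 0 := by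
        linarith
      have h6 := (mul_eq_zero.1 h5).resolve_left h3.ne'
      constructor <;> linarith [hn₁ x, hn₂ x]
    exact ⟨funext fun x => eq_of_log_sub_log_mul_eq_zero (hq.pos₁ x) (hp.pos₁ x) (hz x).1,
      funext fun x => eq_of_log_sub_log_mul_eq_zero (hq.pos₂ x) (hp.pos₂ x) (hz x).2⟩
  · intro x
    exact (((((D₁ x).add (D₂ x)).pow 2).const_mul γ).add (((D₁ x).sub (D₂ x)).pow 2)).congr_deriv
      (by simp; ring)
  · intro x
    exact (((((D₁ x).add (D₂ x)).mul ((E₁ x).add (E₂ x))).const_mul (2 * γ)).add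
      ((((D₁ x).sub (D₂ x)).mul ((E₁ x).sub (E₂ x))).const_mul 2)).congr_deriv
      (by simp; ring)
  · intro x
    have := hn₁ x
    have := hn₂ x
    positivity
  · intro x
    have h1 : (d₁ x + d₂ x) ^ 2 ≤ ((A + C) / 2 + (B + D) / 2) ^ 2 := by
      refine sq_le_sq' ?_ ?_ <;> linarith [abs_le.1 (hb₁ x), abs_le.1 (hb₂ x)]
    have h2 : (d₁ x - d₂ x) ^ 2 ≤ ((A + C) / 2 + (B + D) / 2) ^ 2 := by
      refine sq_le_sq' ?_ ?_ <;> linarith [abs_le.1 (hb₁ x), abs_le.1 (hb₂ x)]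
    gcongr

end DomainWall

/-! ### Existence through the mean field system -/

/-- The element `(k, s • k)` of `L²(ℝ) × L²(ℝ)`, where `k` is the indicator function of the
interval between `0` and `x`. -/
noncomputable def pairIndicatorLp (s x : ℝ) :
    WithLp 2 (Lp ℝ 2 (volume : Measure ℝ) × Lp ℝ 2 (volume : Measure ℝ)) :=
  WithLp.toLp 2 (intervalIndicatorLp x, s • intervalIndicatorLp x)

theorem inner_pairIndicatorLp (s t x y : ℝ) :
    inner ℝ (pairIndicatorLp s x) (pairIndicatorLp t y) =
      (1 + s * t) * ((|x| + |y| - |x - y|) / 2) := by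
  rw [WithLp.prod_inner_apply]
  simp only [pairIndicatorLp, real_inner_smul_left, real_inner_smul_right,
    inner_intervalIndicatorLp]
  ring

theorem continuous_pairIndicatorLp (s : ℝ) : Continuous (pairIndicatorLp s) :=
  (WithLp.prod_continuous_toLp 2 _ _).comp
    (continuous_intervalIndicatorLp.prodMk (continuous_intervalIndicatorLp.const_smul s))

theorem norm_pairIndicatorLp_le (s x : ℝ) :
    ‖pairIndicatorLp s x‖ ≤ (1 + s ^ 2) * (1 + |x|) := by
  refine (sq_le_sq₀ (norm_nonneg _) (by positivity)).1 ?_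
  rw [← real_inner_self_eq_norm_sq, inner_pairIndicatorLp, sub_self, abs_zero, sub_zero,
    add_self_div_two, mul_pow, ← sq s]
  have h1 : (1 + s ^ 2) * 1 ≤ (1 + s ^ 2) ^ 2 := by nlinarith [sq_nonneg s]
  exact mul_le_mul (by linarith) (by nlinarith [abs_nonneg x]) (abs_nonneg x) (by positivity)

/-- Solvability of the mean field system `u j = U j + c j - κ ∑ i, (1 + s i s j) K exp (u i)` with
prescribed masses `∫ exp (u i) = M i`, where `K` is the integral operator with kernel
`(|x| + |y| - |x - y|) / 2`. -/
theorem exists_mean_field {ι : Type*} [Fintype ι] (s M : ι → ℝ) (U : ι → ℝ → ℝ) {κ : ℝ}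
    (hκ : 0 ≤ κ) (hM : ∀ i, 0 < M i) (hU : ∀ i, Continuous (U i))
    (hint : ∀ i (R : ℝ), Integrable fun x => Real.exp (U i x + R * |x|)) :
    ∃ u : ι → ℝ → ℝ, ∃ c : ι → ℝ, (∀ i, Continuous (u i)) ∧
      (∀ i, Integrable fun x => Real.exp (u i x)) ∧
      (∀ i, Integrable fun x => |x| * Real.exp (u i x)) ∧
      (∀ i, ∫ x, Real.exp (u i x) = M i) ∧
      ∀ j x, u j x = U j x + c j - κ * ∑ i, (1 + s i * s j) *
        ∫ y, (|x| + |y| - |x - y|) / 2 * Real.exp (u i y) := by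
  set w : ι → ℝ → ENNReal := fun i x => ENNReal.ofReal (Real.exp (U i x)) with hw
  have hwm : ∀ i, Measurable (w i) := fun i =>
    ENNReal.measurable_ofReal.comp (Real.continuous_exp.comp (hU i)).measurable
  have hwfin : ∀ i, ∀ᵐ x ∂(volume : Measure ℝ), w i x < ⊤ := fun i =>
    Eventually.of_forall fun x => ENNReal.ofReal_lt_top
  have hwr : ∀ i x, (w i x).toReal = Real.exp (U i x) := fun i x =>
    ENNReal.toReal_ofReal (Real.exp_pos _).le
  set ν : ι → Measure ℝ := fun i => volume.withDensity (w i) with hν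
  have hνint : ∀ i (f : ℝ → ℝ), ∫ x, f x ∂ν i = ∫ x, Real.exp (U i x) * f x := fun i f => by
    rw [hν, integral_withDensity_eq_integral_toReal_smul (hwm i) (hwfin i)]
    simp only [hwr, smul_eq_mul]
  have hνi : ∀ i (f : ℝ → ℝ), Integrable f (ν i) ↔ Integrable fun x => Real.exp (U i x) * f x :=
    fun i f => by
      rw [hν, integrable_withDensity_iff_integrable_smul' (hwm i) (hwfin i)]
      simp only [hwr, smul_eq_mul]
  have hνne : ∀ i, NeZero (ν i) := fun i => ⟨fun h0 => by
    have := (withDensity_eq_zero_iff (hwm i).aemeasurable).1 h0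
    obtain ⟨x, hx⟩ := this.exists
    exact (ENNReal.ofReal_pos.2 (Real.exp_pos (U i x))).ne' hx⟩
  have hdom : ∀ i (R : ℝ) (g : ℝ → ℝ), Continuous g →
      (∀ x, |g x| ≤ Real.exp (R * (1 + |x|))) → Integrable fun x => Real.exp (U i x) * g x := by
    intro i R g hg hle
    have hUi := hU i
    refine ((hint i R).const_mul (Real.exp R)).mono' (by fun_prop)
      (Eventually.of_forall fun x => ?_)
    rw [norm_mul, Real.norm_of_nonneg (Real.exp_pos _).le]
    calc _ ≤ Real.exp (U i x) * Real.exp (R * (1 + |x|)) := by gcongr; exact hle x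
      _ = _ := by rw [← Real.exp_add, ← Real.exp_add]; ring_nf
  have hkc : ∀ i, Continuous (pairIndicatorLp (s i)) := fun i => continuous_pairIndicatorLp _
  have hexp : ∀ i (R : ℝ), Integrable (fun x => Real.exp (R * ‖pairIndicatorLp (s i) x‖)) (ν i) := by
    intro i R
    have hki := hkc i
    refine (hνi i _).2 (hdom i (|R| * (1 + s i ^ 2)) _ (by fun_prop) fun x => ?_)
    rw [Real.abs_exp, Real.exp_le_exp, mul_assoc]
    calc _ ≤ |R| * ‖pairIndicatorLp (s i) x‖ := by gcongr; exact le_abs_self R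
      _ ≤ _ := by gcongr; exact norm_pairIndicatorLp_le _ _
  obtain ⟨z, hz⟩ := exists_stationary_log_partition ν (fun i => pairIndicatorLp (s i))
    (fun i => κ * M i) (fun i => mul_nonneg hκ (hM i).le)
    (fun i => (hkc i).aestronglyMeasurable) hexp
  set v : ι → ℝ → ℝ := fun i x => inner ℝ (pairIndicatorLp (s i) x) z with hv
  have hvc : ∀ i, Continuous (v i) := fun i => (hkc i).inner continuous_const
  have hvle : ∀ i x, |v i x| ≤ (1 + s i ^ 2) * ‖z‖ * (1 + |x|) := fun i x => by
    refine (abs_real_inner_le_norm _ _).trans ?_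
    calc _ ≤ (1 + s i ^ 2) * (1 + |x|) * ‖z‖ := by
          gcongr; exact norm_pairIndicatorLp_le _ _
      _ = _ := by ring
  set Z : ι → ℝ := fun i => ∫ x, Real.exp (v i x) ∂ν i with hZ
  have hZpos : ∀ i, 0 < Z i := fun i =>
    integral_exp_inner_pos (hkc i).aestronglyMeasurable (hexp i) z
  have hexpu : ∀ i x, Real.exp (U i x + v i x + Real.log (M i / Z i)) =
      M i / Z i * (Real.exp (U i x) * Real.exp (v i x)) := fun i x => by
    rw [Real.exp_add, Real.exp_add, Real.exp_log (div_pos (hM i) (hZpos i)), mul_comm]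
  -- The additive constant `log (M i / Z i)` normalises the mass of `exp (u i)` to `M i`.
  refine ⟨fun i x => U i x + v i x + Real.log (M i / Z i), fun i => Real.log (M i / Z i),
    fun i => ((hU i).add (hvc i)).add continuous_const, fun i => ?_, fun i => ?_, fun i => ?_,
    fun j x => ?_⟩
  · simp only [hexpu]
    have hvi := hvc i
    refine (hdom i ((1 + s i ^ 2) * ‖z‖) _ (by fun_prop) fun x => ?_).const_mul _
    rw [Real.abs_exp, Real.exp_le_exp]
    exact (le_abs_self _).trans (hvle i x)
  · simp only [hexpu]
    have hvi := hvc i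
    refine ((hdom i ((1 + s i ^ 2) * ‖z‖ + 1) (fun x => |x| * Real.exp (v i x)) (by fun_prop)
      fun x => ?_).const_mul (M i / Z i)).congr (Eventually.of_forall fun x => by ring)
    rw [abs_mul, abs_abs, Real.abs_exp, add_mul, Real.exp_add, mul_comm]
    gcongr
    · exact (le_abs_self _).trans (hvle i x)
    · linarith [Real.add_one_le_exp (1 * (1 + |x|))]
  · simp only [hexpu]
    rw [integral_const_mul, ← hνint]
    exact div_mul_cancel₀ _ (hZpos i).ne'
  -- Stationarity tested against `h = pairIndicatorLp (s j) x` is the integral equation at the point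
  -- `x`.
  · have h1 : v j x = -∑ i, κ * M i *
        ((∫ y, Real.exp (v i y) * inner ℝ (pairIndicatorLp (s i) y) (pairIndicatorLp (s j) x)
          ∂ν i) / Z i) := by
      rw [eq_neg_iff_add_eq_zero, ← hz (pairIndicatorLp (s j) x), real_inner_comm]
    simp only
    rw [h1, Finset.mul_sum]
    have h2 : ∀ i, κ * M i *
        ((∫ y, Real.exp (v i y) * inner ℝ (pairIndicatorLp (s i) y) (pairIndicatorLp (s j) x)
          ∂ν i) / Z i) = κ * ((1 + s i * s j) * ∫ y, (|x| + |y| - |x - y|) / 2 *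
            Real.exp (U i y + v i y + Real.log (M i / Z i))) := by
      intro i
      have h3 : (1 + s i * s j) * ∫ y, (|x| + |y| - |x - y|) / 2 *
            Real.exp (U i y + v i y + Real.log (M i / Z i)) = M i / Z i *
          ∫ y, Real.exp (U i y) * (Real.exp (v i y) *
            inner ℝ (pairIndicatorLp (s i) y) (pairIndicatorLp (s j) x)) := by
        rw [← integral_const_mul, ← integral_const_mul]
        refine integral_congr_ae (Eventually.of_forall fun y => ?_)
        simp only [hexpu, inner_pairIndicatorLp]
        rw [abs_sub_comm x y]
        ring
      rw [hνint, h3]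
      ring
    rw [Finset.sum_congr rfl fun i _ => h2 i]
    ring

section MeanField

variable {ρ ρ₁ ρ₂ : ℝ → ℝ}

theorem integral_kernel_mul (h0 : Integrable ρ) (h1 : Integrable fun y => |y| * ρ y) (x : ℝ) :
    ∫ y, (|x| + |y| - |x - y|) / 2 * ρ y =
      (|x| * (∫ y, ρ y) + (∫ y, |y| * ρ y) - ∫ y, |x - y| * ρ y) / 2 := by
  have h2 : Integrable fun y => |x| * ρ y + |y| * ρ y := (h0.const_mul |x|).add h1
  rw [← integral_const_mul, ← integral_add (h0.const_mul _) h1,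
    ← integral_sub h2 (integrable_abs_sub_mul h0 h1 x), ← integral_div]
  refine integral_congr_ae (Eventually.of_forall fun y => ?_)
  ring

/-- A bound uniform in `x`: the growth of `|x|` cancels against that of `|x - y|`. -/
theorem abs_integral_kernel_mul_le (h0 : Integrable ρ) (h1 : Integrable fun y => |y| * ρ y)
    (x : ℝ) : |∫ y, (|x| + |y| - |x - y|) / 2 * ρ y| ≤ ∫ y, |y| * |ρ y| := by
  have h2 : |∫ y, |y| * ρ y| ≤ ∫ y, |y| * |ρ y| :=
    abs_integral_le_integral_abs.trans (le_of_eq (by simp only [abs_mul, abs_abs]))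
  have h3 := abs_integral_abs_sub_mul_sub_le h0 h1 x
  rw [integral_kernel_mul h0 h1]
  rw [abs_le] at *
  constructor <;> linarith

/-- A mean field solution with balanced masses is twice differentiable and stays within bounded
distance of the decay profile. -/
theorem mean_field_regularity {e ξ α β κ a b c : ℝ} {u : ℝ → ℝ}
    (hc₁ : Continuous ρ₁) (hi₁ : Integrable ρ₁) (hj₁ : Integrable fun y => |y| * ρ₁ y)
    (hc₂ : Continuous ρ₂) (hi₂ : Integrable ρ₂) (hj₂ : Integrable fun y => |y| * ρ₂ y)
    (hbal : κ * (a * (∫ y, ρ₁ y) + b * ∫ y, ρ₂ y) = α + β)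
    (hu : ∀ x, u x = decayProfile e ξ α β x + c -
      κ * (a * (∫ y, (|x| + |y| - |x - y|) / 2 * ρ₁ y) +
        b * ∫ y, (|x| + |y| - |x - y|) / 2 * ρ₂ y)) :
    (∃ u' : ℝ → ℝ, (∀ x, HasDerivAt u (u' x) x) ∧
      ∀ x, HasDerivAt u' (κ * (a * ρ₁ x + b * ρ₂ x) - e ^ 2 * ξ) x) ∧
    ∃ C, ∀ x, |u x - decayProfile e ξ α β x| ≤ C := by
  constructor
  -- By `hbal` the kink `(α + β) / 2 * |x|` of the profile cancels the `|x|` terms of the kernels;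
  -- the remaining potentials are twice differentiable.
  · have hu' : u = fun x => (α - β) / 2 * x - e ^ 2 * ξ / 2 * x ^ 2 +
        κ / 2 * (a * (∫ y, |x - y| * ρ₁ y) + b * ∫ y, |x - y| * ρ₂ y) +
        (c - κ / 2 * (a * (∫ y, |y| * ρ₁ y) + b * ∫ y, |y| * ρ₂ y)) := by
      funext x
      rw [hu, integral_kernel_mul hi₁ hj₁, integral_kernel_mul hi₂ hj₂, decayProfile, ← hbal]
      ring
    rw [hu']
    refine ⟨fun x => (α - β) / 2 - e ^ 2 * ξ * x +
      κ / 2 * (a * (2 * (∫ y in Set.Iic x, ρ₁ y) - ∫ y, ρ₁ y) +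
        b * (2 * (∫ y in Set.Iic x, ρ₂ y) - ∫ y, ρ₂ y)), fun x => ?_, fun x => ?_⟩
    · exact (((((hasDerivAt_id x).const_mul ((α - β) / 2)).sub
        ((hasDerivAt_pow 2 x).const_mul (e ^ 2 * ξ / 2))).add
        ((((hasDerivAt_integral_abs_sub_mul hi₁ hj₁ x).const_mul a).add
          ((hasDerivAt_integral_abs_sub_mul hi₂ hj₂ x).const_mul b)).const_mul (κ / 2))).add_const
        _).congr_deriv (by simp; ring)
    · exact ((((hasDerivAt_id x).const_mul (e ^ 2 * ξ)).const_sub ((α - β) / 2)).add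
        ((((((hasDerivAt_integral_Iic hc₁ hi₁ x).const_mul 2).sub_const _).const_mul a).add
          ((((hasDerivAt_integral_Iic hc₂ hi₂ x).const_mul 2).sub_const _).const_mul b)).const_mul
            (κ / 2))).congr_deriv (by ring)
  · refine ⟨|c| + |κ| * (|a| * (∫ y, |y| * |ρ₁ y|) + |b| * ∫ y, |y| * |ρ₂ y|), fun x => ?_⟩
    rw [hu, add_sub_assoc, add_sub_cancel_left]
    refine (abs_sub _ _).trans ?_
    rw [abs_mul]
    gcongr
    refine (abs_add_le _ _).trans ?_
    rw [abs_mul, abs_mul]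
    gcongr
    · exact abs_integral_kernel_mul_le hi₁ hj₁ x
    · exact abs_integral_kernel_mul_le hi₂ hj₂ x

end MeanField

theorem HasDecay.tendsto {e ξ α β : ℝ} {q : ℝ → ℝ} (he : 0 < e) (hξ : 0 < ξ)
    (hpos : ∀ x, 0 < q x) (h : HasDecay e ξ α β q) :
    Tendsto q atTop (𝓝 0) ∧ Tendsto q atBot (𝓝 0) := by
  have hk : 0 < e ^ 2 * ξ / 2 := by positivity
  have hsqrt : ∀ l : Filter ℝ, Tendsto (fun x => q x ^ 2) l (𝓝 0) → Tendsto q l (𝓝 0) := by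
    intro l hl
    have h2 := (Real.continuous_sqrt.tendsto 0).comp hl
    rw [Real.sqrt_zero] at h2
    exact h2.congr fun x => Real.sqrt_sq (hpos x).le
  constructor
  · refine hsqrt _ (h.1.trans_tendsto (Real.tendsto_exp_atBot.comp ?_))
    have h1 : Tendsto (fun x : ℝ => α - e ^ 2 * ξ / 2 * x) atTop atBot := by
      simp only [sub_eq_add_neg]
      exact tendsto_atBot_add_const_left _ _
        (tendsto_neg_atTop_atBot.comp (tendsto_id.const_mul_atTop hk))
    exact (tendsto_id.atTop_mul_atBot₀ h1).congr fun x => by simp only [id]; ring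
  · refine hsqrt _ (h.2.trans_tendsto (Real.tendsto_exp_atBot.comp ?_))
    have h1 : Tendsto (fun x : ℝ => -β - e ^ 2 * ξ / 2 * x) atBot atTop := by
      simp only [sub_eq_add_neg]
      exact tendsto_atTop_add_const_left _ _
        (tendsto_neg_atBot_atTop.comp (tendsto_id.const_mul_atBot hk))
    exact (tendsto_id.atBot_mul_atTop₀ h1).congr fun x => by simp only [id]; ring

theorem exp_half_sq (t : ℝ) : Real.exp (t / 2) ^ 2 = Real.exp t := by
  rw [sq, ← Real.exp_add, add_halves]

/-! ### Construction of the domain wall and conclusion -/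

section DomainWall

variable {e γ ξ α₁ α₂ β₁ β₂ : ℝ}

theorem contDiff_two_of_hasDerivAt {u u' u'' : ℝ → ℝ} (h : ∀ x, HasDerivAt u (u' x) x)
    (h' : ∀ x, HasDerivAt u' (u'' x) x) (hc : Continuous u'') : ContDiff ℝ 2 u := by
  have h1 : deriv u = u' := funext fun x => (h x).deriv
  have h2 : deriv u' = u'' := funext fun x => (h' x).deriv
  refine (contDiff_succ_iff_deriv (n := 1)).2
    ⟨fun x => (h x).differentiableAt, by simp, contDiff_one_iff_deriv.2 ?_⟩
  rw [h1, h2]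
  exact ⟨fun x => (h' x).differentiableAt, hc⟩

theorem exists_domainWall (he : 0 < e) (hγ : 0 < γ) (hξ : 0 < ξ)
    (hP : PositivityCondition γ α₁ α₂ β₁ β₂) :
    ∃ q₁ q₂ : ℝ → ℝ, IsDomainWall e γ ξ q₁ q₂ ∧
      HasSharpDecay e ξ α₁ β₁ q₁ ∧ HasSharpDecay e ξ α₂ β₂ q₂ := by
  set M₁ := 1 / (2 * e ^ 2 * γ) * ((1 + γ) * (α₁ + β₁) + (γ - 1) * (α₂ + β₂)) with hM₁
  set M₂ := 1 / (2 * e ^ 2 * γ) * ((γ - 1) * (α₁ + β₁) + (1 + γ) * (α₂ + β₂)) with hM₂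
  have hpos₁ : 0 < M₁ := mul_pos (by positivity) hP.1
  have hpos₂ : 0 < M₂ := mul_pos (by positivity) hP.2
  have hs : Real.sqrt γ * Real.sqrt γ = γ := Real.mul_self_sqrt hγ.le
  -- With `s = ±√γ`, the coefficient `1 + s i * s j` is `1 + γ` on the diagonal and `1 - γ` off it.
  obtain ⟨u, c, hc, hi, hj, hm, hu⟩ := exists_mean_field (κ := e ^ 2 / 2)
    ![Real.sqrt γ, -Real.sqrt γ] ![M₁, M₂]
    ![decayProfile e ξ α₁ β₁, decayProfile e ξ α₂ β₂] (by positivity)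
    (by simp [Fin.forall_fin_two, hpos₁, hpos₂])
    (by simp [Fin.forall_fin_two, continuous_decayProfile])
    (by simpa [Fin.forall_fin_two] using
      ⟨integrable_exp_decayProfile he hξ α₁ β₁, integrable_exp_decayProfile he hξ α₂ β₂⟩)
  simp only [Fin.forall_fin_two, Fin.sum_univ_two, Matrix.cons_val_zero, Matrix.cons_val_one,
    neg_mul, mul_neg, hs, neg_neg] at hc hi hj hm hu
  obtain ⟨⟨u₁', hd₁, hd₁'⟩, C₁, hC₁⟩ := mean_field_regularity (e := e) (ξ := ξ) (α := α₁) (β := β₁)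
    (κ := e ^ 2 / 2) (a := 1 + γ) (b := 1 + -γ) (by have := hc.1; fun_prop) hi.1 hj.1
    (by have := hc.2; fun_prop) hi.2 hj.2
    (by rw [hm.1, hm.2, hM₁, hM₂]; field_simp; ring) hu.1
  obtain ⟨⟨u₂', hd₂, hd₂'⟩, C₂, hC₂⟩ := mean_field_regularity (e := e) (ξ := ξ) (α := α₂) (β := β₂)
    (κ := e ^ 2 / 2) (a := 1 + -γ) (b := 1 + γ) (by have := hc.1; fun_prop) hi.1 hj.1
    (by have := hc.2; fun_prop) hi.2 hj.2
    (by rw [hm.1, hm.2, hM₁, hM₂]; field_simp; ring) hu.2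
  obtain ⟨hc₁, hc₂⟩ := hc
  have hq : ∀ i, Continuous (fun x => Real.exp (u i x / 2)) := by
    rw [Fin.forall_fin_two]; constructor <;> fun_prop
  have hlog : ∀ i, (fun y => Real.log (Real.exp (u i y / 2))) = fun y => u i y / 2 := fun i =>
    funext fun y => Real.log_exp _
  have hsharp₁ : HasSharpDecay e ξ α₁ β₁ fun x => Real.exp (u 0 x / 2) := by
    refine (hasSharpDecay_iff (hq 0) fun x => Real.exp_pos _).2 ⟨C₁, fun x => ?_⟩
    rw [Real.log_exp, mul_div_cancel₀ _ two_ne_zero]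
    exact hC₁ x
  have hsharp₂ : HasSharpDecay e ξ α₂ β₂ fun x => Real.exp (u 1 x / 2) := by
    refine (hasSharpDecay_iff (hq 1) fun x => Real.exp_pos _).2 ⟨C₂, fun x => ?_⟩
    rw [Real.log_exp, mul_div_cancel₀ _ two_ne_zero]
    exact hC₂ x
  have ht₁ := hsharp₁.hasDecay.tendsto he hξ fun x => Real.exp_pos _
  have ht₂ := hsharp₂.hasDecay.tendsto he hξ fun x => Real.exp_pos _
  have hsecond : ∀ {v v' : ℝ → ℝ} {a x : ℝ}, (∀ x, HasDerivAt v (v' x) x) →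
      HasDerivAt v' a x → deriv (deriv fun y => v y / 2) x = a / 2 := by
    intro v v' a x h h'
    have h1 : (deriv fun y => v y / 2) = fun y => v' y / 2 :=
      funext fun y => ((h y).div_const 2).deriv
    rw [h1]
    exact (h'.div_const 2).deriv
  refine ⟨fun x => Real.exp (u 0 x / 2), fun x => Real.exp (u 1 x / 2), ?_, hsharp₁, hsharp₂⟩
  exact
    { contDiff₁ := ((contDiff_two_of_hasDerivAt hd₁ hd₁' (by fun_prop)).div_const 2).exp
      contDiff₂ := ((contDiff_two_of_hasDerivAt hd₂ hd₂' (by fun_prop)).div_const 2).exp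
      pos₁ := fun x => Real.exp_pos _
      pos₂ := fun x => Real.exp_pos _
      eqn₁ := fun x => by
        rw [hlog, hsecond hd₁ (hd₁' x), exp_half_sq, exp_half_sq]
        ring
      eqn₂ := fun x => by
        rw [hlog, hsecond hd₂ (hd₂' x), exp_half_sq, exp_half_sq]
        ring
      tendsto_atTop₁ := ht₁.1
      tendsto_atTop₂ := ht₂.1
      tendsto_atBot₁ := ht₁.2
      tendsto_atBot₂ := ht₂.2 }

theorem IsDomainWall.hasExactIntegrals {q₁ q₂ : ℝ → ℝ} (he : 0 < e) (hγ : 0 < γ) (hξ : 0 < ξ)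
    (h : IsDomainWall e γ ξ q₁ q₂) (h₁ : HasSharpDecay e ξ α₁ β₁ q₁)
    (h₂ : HasSharpDecay e ξ α₂ β₂ q₂) : HasExactIntegrals e γ α₁ α₂ β₁ β₂ q₁ q₂ := by
  refine ⟨(h₁.hasDecay.integrable he hξ h.contDiff₁.continuous h.pos₁).1,
    (h₂.hasDecay.integrable he hξ h.contDiff₂.continuous h.pos₂).1, ?_, ?_⟩ <;>
  · rw [← h.balance he hξ h₁ h₂.hasDecay, ← h.symm.balance he hξ h₂ h₁.hasDecay]
    field_simp
    ring

theorem IsDomainWall.hasSharpDecay_of_hasExactIntegrals {q₁ q₂ : ℝ → ℝ} (he : 0 < e)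
    (hγ : 0 < γ) (hξ : 0 < ξ) (h : IsDomainWall e γ ξ q₁ q₂) (h₁ : HasDecay e ξ α₁ β₁ q₁)
    (h₂ : HasDecay e ξ α₂ β₂ q₂) (hI : HasExactIntegrals e γ α₁ α₂ β₁ β₂ q₁ q₂) :
    HasSharpDecay e ξ α₁ β₁ q₁ ∧ HasSharpDecay e ξ α₂ β₂ q₂ := by
  obtain ⟨-, -, I₁, I₂⟩ := hI
  exact ⟨h.hasSharpDecay he hξ h₁ h₂ (by rw [I₁, I₂]; field_simp; ring),
    h.symm.hasSharpDecay he hξ h₂ h₁ (by rw [I₁, I₂]; field_simp; ring)⟩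

theorem IsDomainWall.positivityCondition {q₁ q₂ : ℝ → ℝ} (he : 0 < e) (hγ : 0 < γ) (hξ : 0 < ξ)
    (h : IsDomainWall e γ ξ q₁ q₂) (h₁ : HasSharpDecay e ξ α₁ β₁ q₁)
    (h₂ : HasSharpDecay e ξ α₂ β₂ q₂) : PositivityCondition γ α₁ α₂ β₁ β₂ := by
  obtain ⟨i₁, i₂, I₁, I₂⟩ := h.hasExactIntegrals he hγ hξ h₁ h₂
  have hpos : ∀ {q : ℝ → ℝ}, Integrable (fun x => q x ^ 2) → (∀ x, 0 < q x) →
      0 < ∫ x, q x ^ 2 := fun {q} hi hq => by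
    rw [integral_pos_iff_support_of_nonneg (fun x => sq_nonneg _) hi]
    have : Function.support (fun x => q x ^ 2) = Set.univ :=
      Set.eq_univ_of_forall fun x => (pow_pos (hq x) 2).ne'
    simp [this]
  have hk : (0 : ℝ) < 1 / (2 * e ^ 2 * γ) := by positivity
  exact ⟨(mul_pos_iff_of_pos_left hk).1 (I₁ ▸ hpos i₁ h.pos₁),
    (mul_pos_iff_of_pos_left hk).1 (I₂ ▸ hpos i₂ h.pos₂)⟩

end DomainWall

theorem theorem4p1 (e γ ξ : ℝ) (he : 0 < e) (hγ : 0 < γ) (hξ : 0 < ξ) (α₁ α₂ β₁ β₂ : ℝ) :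
    -- existence and uniqueness, in the class of solutions with the sharp decay
    (PositivityCondition γ α₁ α₂ β₁ β₂ →
      ∃! q : (ℝ → ℝ) × (ℝ → ℝ), IsDomainWall e γ ξ q.1 q.2 ∧
        HasSharpDecay e ξ α₁ β₁ q.1 ∧ HasSharpDecay e ξ α₂ β₂ q.2) ∧
    -- the exact integrals
    (∀ q₁ q₂ : ℝ → ℝ, IsDomainWall e γ ξ q₁ q₂ →
      HasSharpDecay e ξ α₁ β₁ q₁ → HasSharpDecay e ξ α₂ β₂ q₂ →
        HasExactIntegrals e γ α₁ α₂ β₁ β₂ q₁ q₂) ∧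
    -- uniqueness also when only upper bounds are required together with the exact integrals
    (PositivityCondition γ α₁ α₂ β₁ β₂ →
      ∃! q : (ℝ → ℝ) × (ℝ → ℝ), IsDomainWall e γ ξ q.1 q.2 ∧
        HasDecay e ξ α₁ β₁ q.1 ∧ HasDecay e ξ α₂ β₂ q.2 ∧
        HasExactIntegrals e γ α₁ α₂ β₁ β₂ q.1 q.2) ∧
    -- necessity of the positivity conditions
    ((∃ q₁ q₂ : ℝ → ℝ, IsDomainWall e γ ξ q₁ q₂ ∧
      HasSharpDecay e ξ α₁ β₁ q₁ ∧ HasSharpDecay e ξ α₂ β₂ q₂) →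
        PositivityCondition γ α₁ α₂ β₁ β₂) := by
  refine ⟨fun hP => ?_, fun q₁ q₂ h h₁ h₂ => h.hasExactIntegrals he hγ hξ h₁ h₂, fun hP => ?_,
    fun ⟨q₁, q₂, h, h₁, h₂⟩ => h.positivityCondition he hγ hξ h₁ h₂⟩
  · obtain ⟨q₁, q₂, h, h₁, h₂⟩ := exists_domainWall he hγ hξ hP
    refine ⟨(q₁, q₂), ⟨h, h₁, h₂⟩, ?_⟩
    rintro ⟨p₁, p₂⟩ ⟨k, k₁, k₂⟩
    obtain ⟨rfl, rfl⟩ := IsDomainWall.eq_of_hasSharpDecay he hγ k h k₁ k₂ h₁ h₂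
    rfl
  · obtain ⟨q₁, q₂, h, h₁, h₂⟩ := exists_domainWall he hγ hξ hP
    refine ⟨(q₁, q₂), ⟨h, h₁.hasDecay, h₂.hasDecay, h.hasExactIntegrals he hγ hξ h₁ h₂⟩, ?_⟩
    rintro ⟨p₁, p₂⟩ ⟨k, k₁, k₂, kI⟩
    obtain ⟨s₁, s₂⟩ := k.hasSharpDecay_of_hasExactIntegrals he hγ hξ k₁ k₂ kI
    obtain ⟨rfl, rfl⟩ := IsDomainWall.eq_of_hasSharpDecay he hγ k h s₁ s₂ h₁ h₂
    rfl
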